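/- Let $\psi:\mathbb R\to\mathbb R$ be a nonnegative Schwartz function whose Fourier transform $\hat\psi(\omega)=\int_{\mathbb R}\psi(t)e^{-i\omega t}\,dt$ is supported in $[-1,1]$, and let $c>0$. There is a constant $C>0$, depending only on $\psi$ and $c$, such that the following holds. Let $\mu\in C^\infty(\mathbb R^3)$ be supported in $\{\xi\in\mathbb R^3: \tfrac12\le\|\xi\|\le 2\}$ with $\sum_{k\in\mathbb Z}\mu(2^{-k}\xi)=1$ for all $\xi\ne 0$. For $F\in L^2(\mathbb R^3)$ and $k\in\mathbb Z$ define $S_kF\in L^2(\mathbb R^3)$ by $\widehat{S_kF}(\xi)=\mu(2^{-k}\xi)\,\hat F(\xi)$, where $\hat F$ is the Fourier transform with kernel $e^{-ix\cdot\xi}$. Let $\Sigma\subset S^2$ be a set of $N$ unit vectors in $\mathbb R^3$ such that $$\|v-v'\|\ge c\,N^{-1/2}\qquad\text{for all } v\ne v'\in\Sigma .$$ For $G\in L^2(\mathbb R^3)$ put $$M_0G(x)=\max_{v\in\Sigma}\Big|\int_{\mathbb R}G(x+tv)\,\psi(t)\,dt\Big| .$$ Then for every integer $k\ge 0$ and every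 (complex-valued) $F\in L^2(\mathbb R^3)$, the integrals defining $M_0(S_kF)(x)$ converge absolutely for almost every $x$, $M_0(S_kF)\in L^2(\mathbb R^3)$, and $$\|M_0(S_kF)\|_{L^2(\mathbb R^3)}\le C\,N^{1/4}\,\|S_kF\|_{L^2(\mathbb R^3)} .$$ -/

import Mathlib

open MeasureTheory
open scoped FourierTransform ENNReal NNReal ContDiff

noncomputable section

/-- Three-dimensional Euclidean space. -/
abbrev R3 : Type := EuclideanSpace ℝ (Fin 3)

/-- The dyadic annulus `{ξ : 2^(k-1) ≤ ‖ξ‖ ≤ 2^(k+1)}`. -/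
def dyadicAnnulus (k : ℤ) : Set R3 :=
  {ξ | (2 : ℝ) ^ (k - 1) ≤ ‖ξ‖ ∧ ‖ξ‖ ≤ (2 : ℝ) ^ (k + 1)}

/-- The Fourier transform on the line in the angular-frequency convention,
`s ↦ ∫ ψ(t) e^{-ist} dt`. -/
def angularFourier (ψ : ℝ → ℝ) (s : ℝ) : ℂ :=
  ∫ t : ℝ, Complex.exp (-Complex.I * s * t) * (ψ t : ℂ)

/-- A smooth function `μ` supported in the annulus `{1/2 ≤ ‖ξ‖ ≤ 2}` whose dyadic dilates
`μ(2^{-k} ·)`, `k ∈ ℤ`, sum to one away from the origin. -/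
structure DyadicCutoff where
  toFun : R3 → ℂ
  smooth : ContDiff ℝ ∞ toFun
  support_subset : Function.support toFun ⊆ dyadicAnnulus 0
  partition : ∀ ξ : R3, ξ ≠ 0 → HasSum (fun k : ℤ => toFun ((2 : ℝ) ^ (-k) • ξ)) 1

/-- The dilate `μ_k(ξ) = μ(2^{-k} ξ)`. -/
def DyadicCutoff.dilate (μ : DyadicCutoff) (k : ℤ) (ξ : R3) : ℂ :=
  μ.toFun ((2 : ℝ) ^ (-k) • ξ)

/-- The product of `μ_k` with an `L²` function of the variable `ζ = ξ / (2π)` is in `L²`. -/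
theorem DyadicCutoff.memLp_dilate_mul (μ : DyadicCutoff) (k : ℤ)
    (G : Lp ℂ 2 (volume : Measure R3)) :
    MemLp (fun ζ : R3 => μ.dilate k ((2 * Real.pi) • ζ) * G ζ) 2 volume := by
  have hc : Continuous μ.toFun := μ.smooth.continuous
  have hcs : HasCompactSupport μ.toFun := by
    refine HasCompactSupport.intro (isCompact_closedBall (0 : R3) 2) fun x hx => ?_
    by_contra h
    apply hx
    have h2 := (μ.support_subset (Function.mem_support.mpr h)).2
    simpa using h2
  obtain ⟨C, hC⟩ := hcs.exists_bound_of_continuous hc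
  refine MemLp.of_le_mul (c := C) (Lp.memLp G) ?_ (Filter.Eventually.of_forall fun ζ => ?_)
  · refine AEStronglyMeasurable.mul ?_ (Lp.aestronglyMeasurable G)
    refine Continuous.aestronglyMeasurable ?_
    unfold DyadicCutoff.dilate
    fun_prop
  · rw [norm_mul]
    exact mul_le_mul_of_nonneg_right (hC _) (norm_nonneg _)

/-- The frequency localization `S_k` on `L²(ℝ³)`: the Fourier multiplier with symbol `μ_k(ξ)`
in the angular-frequency variable `ξ`. Mathlib's Fourier transform `𝓕` uses the kernel
`e^{-2πi x·ζ}`, so that `ξ = 2π ζ`. -/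
def freqLocalize (μ : DyadicCutoff) (k : ℤ) (F : Lp ℂ 2 (volume : Measure R3)) :
    Lp ℂ 2 (volume : Measure R3) :=
  𝓕⁻ ((μ.memLp_dilate_mul k (𝓕 F)).toLp _)

/-- The smoothed average `T_v G(x) = ∫ G(x + t v) ψ(t) dt`. -/
def directionalAverage (ψ : ℝ → ℝ) (v : R3) (G : R3 → ℂ) (x : R3) : ℂ :=
  ∫ t : ℝ, G (x + t • v) * (ψ t : ℂ)

/-- The maximal function `M₀ G(x) = max_{v ∈ S} |T_v G(x)|` over a finite set `S` of directions
(zero if `S` is empty). -/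
def directionalMax (ψ : ℝ → ℝ) (S : Finset R3) (G : R3 → ℂ) (x : R3) : ℝ :=
  ((S.sup fun v => ‖directionalAverage ψ v G x‖₊ : ℝ≥0) : ℝ)

end

/-! Averaging in the direction `v` multiplies the Fourier transform by `m ⟪ζ, v⟫`, where `m` is the
Fourier transform of `ψ` up to scaling, and `m` vanishes off a bounded interval. A frequency
`‖ζ‖ ∼ 1 / ε` is therefore only seen by the directions within `O(ε)` of the plane orthogonal to `ζ`.
Put `ρ = N ^ (-1 / 2)`.

If `ε ≤ ρ`, the maximum is dominated by the `ℓ²` sum over the directions. By Plancherel it remains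
to count, for each `ζ`, the directions within `O(ρ)` of a great circle; these are `cρ`-separated,
so there are `O(1 / ρ)` of them.

If `ρ ≤ ε`, the supremum is taken over the whole sphere. As the frequencies are `O(1 / ε)`, the
Sobolev inequality on cubes of side `ε` replaces it by `ε⁻³` times an integral over the directions
`u` with `‖u‖ = 1 + O(ε)`. By Plancherel and Fubini, each `ζ` then contributes the volume of the `u`
in this shell that are `O(ε)`-close to the plane orthogonal to `ζ`. That volume is `O(ε²)`, so the
total is `O(1 / ε)`. -/

theorem eLpNorm_two_sq {α F : Type*} [MeasurableSpace α] [NormedAddCommGroup F] (f : α → F)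
    (ν : Measure α) : eLpNorm f 2 ν ^ 2 = ∫⁻ x, ‖f x‖ₑ ^ 2 ∂ν := by
  simpa using eLpNorm_nnreal_pow_eq_lintegral (f := f) (μ := ν) (p := 2) two_ne_zero

section FourierInverse

variable {E : Type*} [NormedAddCommGroup E] [InnerProductSpace ℝ E] [MeasurableSpace E]
  [BorelSpace E] [FiniteDimensional ℝ E]

theorem integral_fourierInv_mul_eq {f g : E → ℂ} (hf : Integrable f) (hg : Integrable g) :
    ∫ ξ, 𝓕⁻ f ξ * g ξ = ∫ x, f x * 𝓕⁻ g x := by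
  have h := VectorFourier.integral_fourierIntegral_smul_eq_flip (e := Real.fourierChar)
    (μ := (volume : Measure E)) (ν := (volume : Measure E)) (L := -innerₗ E) (f := f) (g := g)
    Real.continuous_fourierChar
    (show Continuous fun p : E × E => -inner ℝ p.1 p.2 from continuous_inner.neg) hf hg
  have hflip : (-innerₗ E).flip = -innerₗ E := by
    ext x y
    simp [real_inner_comm]
  rw [hflip] at h
  exact h

theorem continuous_fourierInv {f : E → ℂ} (hf : Integrable f) : Continuous (𝓕⁻ f) :=
  VectorFourier.fourierIntegral_continuous (L := -innerₗ E) Real.continuous_fourierChar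
    (show Continuous fun p : E × E => -inner ℝ p.1 p.2 from continuous_inner.neg) hf

theorem fourierInv_toLp_ae_eq {f : E → ℂ} (hf : Integrable f) (hf2 : MemLp f 2 volume) :
    (𝓕⁻ (hf2.toLp f) : Lp ℂ 2 (volume : Measure E)) =ᵐ[volume] 𝓕⁻ f := by
  refine ae_eq_of_integral_contDiff_smul_eq
    ((Lp.memLp (𝓕⁻ (hf2.toLp f))).locallyIntegrable one_le_two)
    (continuous_fourierInv hf).locallyIntegrable fun g hg hgs => ?_
  have hg1 : ContDiff ℝ ∞ (fun x => (g x : ℂ)) := Complex.ofRealCLM.contDiff.comp hg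
  have hg2 : HasCompactSupport (fun x => (g x : ℂ)) := hgs.comp_left Complex.ofReal_zero
  let φ := hg2.toSchwartzMap hg1
  have hφg : ∀ x, φ x = (g x : ℂ) := fun _ => rfl
  have hdual := DFunLike.congr_fun (Lp.fourierInv_toTemperedDistribution_eq (hf2.toLp f)) φ
  rw [TemperedDistribution.fourierInv_apply, Lp.toTemperedDistribution_apply,
    Lp.toTemperedDistribution_apply] at hdual
  calc ∫ x, g x • (𝓕⁻ (hf2.toLp f) : Lp ℂ 2 (volume : Measure E)) x
      = ∫ x, φ x • (𝓕⁻ (hf2.toLp f) : Lp ℂ 2 (volume : Measure E)) x := by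
        simp [hφg]
    _ = ∫ x, (𝓕⁻ φ) x • (hf2.toLp f) x := hdual.symm
    _ = ∫ x, 𝓕⁻ (φ : E → ℂ) x * f x := by
        refine integral_congr_ae ?_
        filter_upwards [hf2.coeFn_toLp] with x hx
        rw [hx, SchwartzMap.fourierInv_coe, smul_eq_mul]
    _ = ∫ x, φ x * 𝓕⁻ f x := integral_fourierInv_mul_eq φ.integrable hf
    _ = ∫ x, g x • 𝓕⁻ f x := by simp [hφg]

theorem eLpNorm_fourierInv_toLp {f : E → ℂ} (hf2 : MemLp f 2 volume) :
    eLpNorm (𝓕⁻ (hf2.toLp f) : Lp ℂ 2 (volume : Measure E)) 2 volume = eLpNorm f 2 volume := by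
  have h : ‖(𝓕⁻ (hf2.toLp f) : Lp ℂ 2 (volume : Measure E))‖ = ‖hf2.toLp f‖ :=
    (Lp.fourierTransformₗᵢ E ℂ).symm.norm_map _
  rw [← Lp.enorm_def, ← eLpNorm_congr_ae hf2.coeFn_toLp, ← Lp.enorm_def, ← ofReal_norm, h,
    ofReal_norm]

theorem lintegral_enorm_fourierInv_sq {f : E → ℂ} (hf : Integrable f) (hf2 : MemLp f 2 volume) :
    ∫⁻ x, ‖𝓕⁻ f x‖ₑ ^ 2 = ∫⁻ ξ, ‖f ξ‖ₑ ^ 2 := by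
  rw [← eLpNorm_two_sq, ← eLpNorm_two_sq, ← eLpNorm_fourierInv_toLp hf2,
    eLpNorm_congr_ae (fourierInv_toLp_ae_eq hf hf2)]

end FourierInverse

section Sobolev

variable {F : Type*} [NormedAddCommGroup F]

theorem sq_setLIntegral_enorm_le {α : Type*} [MeasurableSpace α] {ν : Measure α} {f : α → F}
    {s : Set α} (hf : AEStronglyMeasurable f (ν.restrict s)) :
    (∫⁻ x in s, ‖f x‖ₑ ∂ν) ^ 2 ≤ ν s * ∫⁻ x in s, ‖f x‖ₑ ^ 2 ∂ν := by
  have h := pow_le_pow_left' (eLpNorm_le_eLpNorm_mul_rpow_measure_univ one_le_two hf) 2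
  rw [eLpNorm_one_eq_lintegral_enorm, mul_pow, eLpNorm_two_sq, Measure.restrict_apply_univ,
    ← ENNReal.rpow_mul_natCast] at h
  norm_num at h
  rwa [mul_comm] at h

variable [NormedSpace ℝ F] {δ : ℝ}

theorem enorm_sq_le_add_sq_lintegral_deriv {f : ℝ → F} (hf : ContDiff ℝ 1 f) {p s : ℝ}
    (hs : s ∈ Set.Icc p (p + δ)) :
    ‖f p‖ₑ ^ 2 ≤ 2 * (‖f s‖ₑ ^ 2 + (∫⁻ t in Set.Icc p (p + δ), ‖deriv f t‖ₑ) ^ 2) := by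
  have hsub : ‖f s - f p‖ₑ ≤ ∫⁻ t in Set.Icc p (p + δ), ‖deriv f t‖ₑ :=
    (enorm_sub_le_lintegral_deriv_of_contDiffOn_Icc hf.contDiffOn hs.1).trans
      (lintegral_mono_set (Set.Icc_subset_Icc_right hs.2))
  calc ‖f p‖ₑ ^ 2 = ‖f s - (f s - f p)‖ₑ ^ 2 := by rw [sub_sub_cancel]
    _ ≤ (‖f s‖ₑ + ∫⁻ t in Set.Icc p (p + δ), ‖deriv f t‖ₑ) ^ 2 := by
        gcongr
        exact enorm_sub_le.trans (by gcongr)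
    _ ≤ 2 * (‖f s‖ₑ ^ 2 + (∫⁻ t in Set.Icc p (p + δ), ‖deriv f t‖ₑ) ^ 2) := by
        simpa [show (2 : ℝ) - 1 = 1 by norm_num] using
          ENNReal.rpow_add_le_mul_rpow_add_rpow ‖f s‖ₑ _ (p := 2) one_le_two

theorem enorm_sq_le_lintegral_Icc (hδ : 0 < δ) {f : ℝ → F} (hf : ContDiff ℝ 1 f) (p : ℝ) :
    ‖f p‖ₑ ^ 2 ≤ ENNReal.ofReal (2 / δ) *
      ∫⁻ s in Set.Icc p (p + δ), (‖f s‖ₑ ^ 2 + ‖δ • deriv f s‖ₑ ^ 2) := by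
  let I := Set.Icc p (p + δ)
  have hvol : volume I = ENNReal.ofReal δ := by simp [I]
  have hf' : Continuous (deriv f) := hf.continuous_deriv_one
  have hder : (∫⁻ t in I, ‖deriv f t‖ₑ) ^ 2 ≤
      ENNReal.ofReal δ * ∫⁻ s in I, ‖deriv f s‖ₑ ^ 2 :=
    hvol ▸ sq_setLIntegral_enorm_le hf'.aestronglyMeasurable
  have hscale : ∫⁻ s in I, ‖δ • deriv f s‖ₑ ^ 2 =
      ENNReal.ofReal δ ^ 2 * ∫⁻ s in I, ‖deriv f s‖ₑ ^ 2 := by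
    rw [← lintegral_const_mul' _ _ (by finiteness)]
    simp only [enorm_smul, Real.enorm_of_nonneg hδ.le, mul_pow]
  rw [ENNReal.ofReal_div_of_pos hδ, ENNReal.ofReal_ofNat, ← ENNReal.mul_div_right_comm,
    ENNReal.le_div_iff_mul_le (by simp [hδ]) (by simp), mul_comm,
    lintegral_add_left (hf.continuous.enorm.measurable.pow_const 2), hscale]
  calc ENNReal.ofReal δ * ‖f p‖ₑ ^ 2
      = ∫⁻ _ in I, ‖f p‖ₑ ^ 2 := by rw [setLIntegral_const, hvol, mul_comm]
    _ ≤ ∫⁻ s in I, 2 * (‖f s‖ₑ ^ 2 + (∫⁻ t in I, ‖deriv f t‖ₑ) ^ 2) :=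
        setLIntegral_mono' measurableSet_Icc fun s hs => enorm_sq_le_add_sq_lintegral_deriv hf hs
    _ = 2 * ((∫⁻ s in I, ‖f s‖ₑ ^ 2) + (∫⁻ t in I, ‖deriv f t‖ₑ) ^ 2 * ENNReal.ofReal δ) := by
        rw [lintegral_const_mul' _ _ ENNReal.ofNat_ne_top,
          lintegral_add_right _ measurable_const, setLIntegral_const, hvol]
    _ ≤ 2 * ((∫⁻ s in I, ‖f s‖ₑ ^ 2) +
          (ENNReal.ofReal δ * ∫⁻ s in I, ‖deriv f s‖ₑ ^ 2) * ENNReal.ofReal δ) := by gcongr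
    _ = 2 * ((∫⁻ s in I, ‖f s‖ₑ ^ 2) +
          ENNReal.ofReal δ ^ 2 * ∫⁻ s in I, ‖deriv f s‖ₑ ^ 2) := by ring

variable {ι : Type*} [DecidableEq ι]

theorem enorm_sq_le_lmarginal [Countable ι] (hδ : 0 < δ) {g : Finset ι → (ι → ℝ) → F}
    (hg : ∀ α, Continuous (g α))
    (hg' : ∀ α, ∀ i ∉ α, ∀ x t, HasDerivAt (fun r => g α (Function.update x i r))
      (δ⁻¹ • g (insert i α) (Function.update x i t)) t)
    (p : ι → ℝ) (s : Finset ι) :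
    ∀ {α : Finset ι}, Disjoint s α → ∀ {x : ι → ℝ}, (∀ i ∈ s, x i = p i) →
      ‖g α x‖ₑ ^ 2 ≤ ENNReal.ofReal (2 / δ) ^ s.card *
        (∫⋯∫⁻_s, fun y => ∑ β ∈ s.powerset, ‖g (β ∪ α) y‖ₑ ^ 2
          ∂fun i => volume.restrict (Set.Icc (p i) (p i + δ))) x := by
  induction s using Finset.induction with
  | empty => intro α _ x _; simp
  | insert i s hi ih =>
    intro α hα x hx
    obtain ⟨hiα, hsα⟩ := Finset.disjoint_insert_left.1 hα
    have hupd : Continuous fun t => Function.update x i t := by fun_prop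
    have hderiv : deriv (fun t => g α (Function.update x i t)) =
        fun t => δ⁻¹ • g (insert i α) (Function.update x i t) :=
      funext fun t => (hg' α i hiα x t).deriv
    have hC1 : ContDiff ℝ 1 fun t => g α (Function.update x i t) := contDiff_one_iff_deriv.2
      ⟨fun t => (hg' α i hiα x t).differentiableAt, by
        rw [hderiv]; exact ((hg _).comp hupd).const_smul _⟩
    have hmeas : ∀ u α, Measurable fun y => ∑ β ∈ u, ‖g (β ∪ α) y‖ₑ ^ 2 := fun u α =>
      Finset.measurable_fun_sum _ fun β _ => (hg _).enorm.measurable.pow_const 2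
    have hx' : ∀ t, ∀ j ∈ s, Function.update x i t j = p j := fun t j hj => by
      rw [Function.update_of_ne (ne_of_mem_of_not_mem hj hi), hx j (Finset.mem_insert_of_mem hj)]
    have hsum : ∀ y, ∑ β ∈ (insert i s).powerset, ‖g (β ∪ α) y‖ₑ ^ 2 =
        ∑ β ∈ s.powerset, ‖g (β ∪ α) y‖ₑ ^ 2 +
          ∑ β ∈ s.powerset, ‖g (β ∪ insert i α) y‖ₑ ^ 2 := fun y => by
      simp only [Finset.sum_powerset_insert hi, Finset.insert_union, Finset.union_insert]
    have hone := enorm_sq_le_lintegral_Icc hδ hC1 (p i)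
    simp only [hderiv, smul_inv_smul₀ hδ.ne', ← hx i (Finset.mem_insert_self i s),
      Function.update_eq_self] at hone
    rw [lmarginal_insert _ (hmeas _ _) hi, Finset.card_insert_of_notMem hi,
      pow_succ' (ENNReal.ofReal _), mul_assoc,
      ← lintegral_const_mul' _ _ (by finiteness), ← hx i (Finset.mem_insert_self i s)]
    refine hone.trans (mul_le_mul_right (lintegral_mono fun t => ?_) _)
    simp only [hsum]
    refine (add_le_add (ih hsα (hx' t)) (ih (Finset.disjoint_insert_right.2 ⟨hi, hsα⟩)
      (hx' t))).trans ?_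
    rw [← mul_add]
    exact mul_le_mul_right (le_lintegral_add _ _) _

theorem enorm_sq_le_lintegral_cube [Fintype ι] (hδ : 0 < δ) {g : Finset ι → (ι → ℝ) → F}
    (hg : ∀ α, Continuous (g α))
    (hg' : ∀ α, ∀ i ∉ α, ∀ x t, HasDerivAt (fun r => g α (Function.update x i r))
      (δ⁻¹ • g (insert i α) (Function.update x i t)) t) (p : ι → ℝ) :
    ‖g ∅ p‖ₑ ^ 2 ≤ ENNReal.ofReal (2 / δ) ^ Fintype.card ι *
      ∫⁻ x in Set.Icc p fun i => p i + δ, ∑ α, ‖g α x‖ₑ ^ 2 := by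
  have h := enorm_sq_le_lmarginal hδ hg hg' p Finset.univ (Finset.disjoint_empty_right _)
    (x := p) fun i _ => rfl
  simpa only [lmarginal_univ, ← Measure.restrict_pi_pi, Set.pi_univ_Icc, Finset.powerset_univ,
    Finset.union_empty, Finset.card_univ, ← volume_pi] using h

end Sobolev

section RidgeSymbol

variable {E : Type*} [NormedAddCommGroup E] [InnerProductSpace ℝ E]

/-- The Fourier symbol `h ζ * m ⟪ζ, u⟫`: the frequency profile `h`, filtered by the multiplier
`m` in the direction `u`, which is an arbitrary vector. -/
def ridgeSymbol (h : E → ℂ) (m : ℝ → ℂ) (u ζ : E) : ℂ := h ζ * m (inner ℝ ζ u)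

variable {h : E → ℂ} {m : ℝ → ℂ} {b : ℝ}

theorem norm_ridgeSymbol_le (hb : ∀ s, ‖m s‖ ≤ b) (u ζ : E) :
    ‖ridgeSymbol h m u ζ‖ ≤ b * ‖h ζ‖ := by
  rw [ridgeSymbol, norm_mul, mul_comm]
  exact mul_le_mul_of_nonneg_right (hb _) (norm_nonneg _)

variable [MeasurableSpace E] [BorelSpace E] {μ : Measure E}

theorem aestronglyMeasurable_ridgeSymbol [SecondCountableTopology E]
    (hh : AEStronglyMeasurable h μ) (hm : Continuous m) (u : E) :
    AEStronglyMeasurable (ridgeSymbol h m u) μ :=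
  hh.mul (Continuous.aestronglyMeasurable (by fun_prop))

theorem memLp_ridgeSymbol [SecondCountableTopology E] {p : ℝ≥0∞} (hh : MemLp h p μ)
    (hm : Continuous m) (hb : ∀ s, ‖m s‖ ≤ b) (u : E) : MemLp (ridgeSymbol h m u) p μ :=
  hh.of_le_mul (aestronglyMeasurable_ridgeSymbol hh.1 hm u) <|
    Filter.Eventually.of_forall (norm_ridgeSymbol_le hb u)

theorem aestronglyMeasurable_fourierChar_smul {f : E → ℂ} (hf : AEStronglyMeasurable f μ) (x : E) :
    AEStronglyMeasurable (fun ζ => Real.fourierChar (inner ℝ ζ x) • f ζ) μ := by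
  have := Real.continuous_fourierChar
  have hchar : Continuous fun ζ : E => (Real.fourierChar (inner ℝ ζ x) : ℂ) := by fun_prop
  exact hchar.aestronglyMeasurable.smul hf

variable [FiniteDimensional ℝ E]

theorem integrable_ridgeSymbol (hh : Integrable h) (hm : Continuous m) (hb : ∀ s, ‖m s‖ ≤ b)
    (u : E) : Integrable (ridgeSymbol h m u) :=
  memLp_one_iff_integrable.1 (memLp_ridgeSymbol (memLp_one_iff_integrable.2 hh) hm hb u)

theorem continuous_fourierInv_ridgeSymbol (hh : Integrable h) (hm : Continuous m)
    (hb : ∀ s, ‖m s‖ ≤ b) :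
    Continuous fun p : E × E => 𝓕⁻ (ridgeSymbol h m p.1) p.2 := by
  simp only [Real.fourierInv_eq]
  refine continuous_of_dominated (bound := fun ζ => b * ‖h ζ‖)
    (fun p => aestronglyMeasurable_fourierChar_smul
      (aestronglyMeasurable_ridgeSymbol hh.1 hm p.1) p.2)
    (fun p => Filter.Eventually.of_forall fun ζ => ?_) (hh.norm.const_mul b)
    (Filter.Eventually.of_forall fun ζ => ?_)
  · rw [Circle.norm_smul]
    exact norm_ridgeSymbol_le hb p.1 ζ
  · have := Real.continuous_fourierChar
    unfold ridgeSymbol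
    fun_prop

theorem hasDerivAt_fourierInv_ridgeSymbol {w : E} {γ : ℝ → E} (hh : Integrable h)
    (hhw : Integrable fun ζ => (inner ℝ ζ w : ℂ) * h ζ) (hm : ContDiff ℝ 1 m)
    (hb : ∀ s, ‖m s‖ ≤ b) (hb' : ∀ s, ‖deriv m s‖ ≤ b) (hγ : ∀ t, HasDerivAt γ w t)
    (x : E) (t : ℝ) :
    HasDerivAt (fun t => 𝓕⁻ (ridgeSymbol h m (γ t)) x)
      (𝓕⁻ (ridgeSymbol (fun ζ => (inner ℝ ζ w : ℂ) * h ζ) (deriv m) (γ t)) x) t := by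
  have hm' : Continuous (deriv m) := hm.continuous_deriv_one
  simp only [Real.fourierInv_eq]
  refine (hasDerivAt_integral_of_dominated_loc_of_deriv_le (x₀ := t)
    (F' := fun s ζ => Real.fourierChar (inner ℝ ζ x) •
      ridgeSymbol (fun ζ => (inner ℝ ζ w : ℂ) * h ζ) (deriv m) (γ s) ζ)
    (bound := fun ζ => b * ‖(inner ℝ ζ w : ℂ) * h ζ‖) Filter.univ_mem
    (Filter.Eventually.of_forall fun s => aestronglyMeasurable_fourierChar_smul
      (aestronglyMeasurable_ridgeSymbol hh.1 hm.continuous (γ s)) x)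
    ((integrable_ridgeSymbol hh hm.continuous hb (γ t)).mono
      (aestronglyMeasurable_fourierChar_smul
        (aestronglyMeasurable_ridgeSymbol hh.1 hm.continuous (γ t)) x)
      (Filter.Eventually.of_forall fun ζ => (Circle.norm_smul _ _).le))
    (aestronglyMeasurable_fourierChar_smul (aestronglyMeasurable_ridgeSymbol hhw.1 hm' (γ t)) x)
    (Filter.Eventually.of_forall fun ζ s _ => ?_) (hhw.norm.const_mul b)
    (Filter.Eventually.of_forall fun ζ s _ => ?_)).2
  · rw [Circle.norm_smul]
    exact norm_ridgeSymbol_le hb' (γ s) ζ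
  · have hinner : HasDerivAt (fun t => inner ℝ ζ (γ t)) (inner ℝ ζ w) s := by
      simpa using (hasDerivAt_const s ζ).inner ℝ (hγ s)
    have hcomp := ((hm.differentiable_one _).hasDerivAt.scomp s hinner).const_mul (h ζ)
    refine (hcomp.const_smul (Real.fourierChar (inner ℝ ζ x))).congr_deriv ?_
    simp only [ridgeSymbol, Complex.real_smul]
    ring_nf

theorem lintegral_fourierInv_ridgeSymbol_sq_le {R : ℝ} (hh : Integrable h) (hh2 : MemLp h 2)
    (hm : Continuous m) (hb : ∀ s, ‖m s‖ ≤ b) (hR : ∀ s, m s ≠ 0 → |s| ≤ R) (u : E) :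
    ∫⁻ x, ‖𝓕⁻ (ridgeSymbol h m u) x‖ₑ ^ 2 ≤
      ENNReal.ofReal b ^ 2 * ∫⁻ ζ in {ζ | |inner ℝ ζ u| ≤ R}, ‖h ζ‖ₑ ^ 2 := by
  have hslab : MeasurableSet {ζ : E | |inner ℝ ζ u| ≤ R} :=
    measurableSet_le (by fun_prop) (by fun_prop)
  rw [lintegral_enorm_fourierInv_sq (integrable_ridgeSymbol hh hm hb u)
    (memLp_ridgeSymbol hh2 hm hb u), ← lintegral_const_mul' _ _ (by finiteness),
    ← lintegral_indicator hslab]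
  refine lintegral_mono fun ζ => ?_
  by_cases hζ : m (inner ℝ ζ u) = 0
  · simp [ridgeSymbol, hζ]
  · rw [Set.indicator_of_mem (show ζ ∈ {ζ | |inner ℝ ζ u| ≤ R} from hR _ hζ), ← mul_pow]
    gcongr
    rw [← ofReal_norm, ← ofReal_norm, ← ENNReal.ofReal_mul ((norm_nonneg _).trans (hb 0))]
    exact ENNReal.ofReal_le_ofReal (norm_ridgeSymbol_le hb u ζ)

theorem lintegral_setLIntegral_slab_le {F : Type*} [NormedAddCommGroup F] {f : E → F}
    (hf : AEStronglyMeasurable f) {ν : Measure E} [SFinite ν] {R : ℝ} {K : ℝ≥0∞}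
    (hν : ∀ ζ, f ζ ≠ 0 → ν {u | |inner ℝ ζ u| ≤ R} ≤ K) :
    ∫⁻ u, (∫⁻ ζ in {ζ | |inner ℝ ζ u| ≤ R}, ‖f ζ‖ₑ ^ 2) ∂ν ≤ K * ∫⁻ ζ, ‖f ζ‖ₑ ^ 2 := by
  have hslab : MeasurableSet {p : E × E | |inner ℝ p.2 p.1| ≤ R} :=
    measurableSet_le (by fun_prop) (by fun_prop)
  let Φ : E → E → ℝ≥0∞ := fun u ζ => {ζ | |inner ℝ ζ u| ≤ R}.indicator (fun ζ => ‖f ζ‖ₑ ^ 2) ζ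
  have hΦ : AEMeasurable (Function.uncurry Φ) (ν.prod volume) :=
    (hf.enorm.pow_const 2).comp_snd.indicator hslab
  calc ∫⁻ u, (∫⁻ ζ in {ζ | |inner ℝ ζ u| ≤ R}, ‖f ζ‖ₑ ^ 2) ∂ν
      = ∫⁻ u, (∫⁻ ζ, Φ u ζ) ∂ν := lintegral_congr fun u =>
        (lintegral_indicator (hslab.preimage measurable_prodMk_left) _).symm
    _ = ∫⁻ ζ, (∫⁻ u, Φ u ζ ∂ν) := lintegral_lintegral_swap hΦ
    _ = ∫⁻ ζ, ‖f ζ‖ₑ ^ 2 * ν {u | |inner ℝ ζ u| ≤ R} := lintegral_congr fun ζ =>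
        lintegral_indicator_const (hslab.preimage measurable_prodMk_right) _
    _ ≤ ∫⁻ ζ, K * ‖f ζ‖ₑ ^ 2 := lintegral_mono fun ζ => by
        by_cases hζ : f ζ = 0
        · simp [hζ]
        · rw [mul_comm]
          exact mul_le_mul_left (hν ζ hζ) _
    _ = K * ∫⁻ ζ, ‖f ζ‖ₑ ^ 2 := lintegral_const_mul'' _ (hf.enorm.pow_const 2)

end RidgeSymbol

section RidgeDeriv

variable {φ : ℝ → ℂ} {b R : ℝ}

theorem abs_le_of_iteratedDeriv_ne_zero (hR : ∀ s, φ s ≠ 0 → |s| ≤ R) (n : ℕ) (s : ℝ)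
    (hs : iteratedDeriv n φ s ≠ 0) : |s| ≤ R := by
  have hsupp : tsupport φ ⊆ {s | |s| ≤ R} :=
    closure_minimal hR (isClosed_le continuous_abs continuous_const)
  refine hsupp (support_iteratedFDeriv_subset (𝕜 := ℝ) n fun h => hs ?_)
  rw [iteratedDeriv_eq_iteratedFDeriv, h, zero_apply]

variable {ι : Type*} [Fintype ι]

/-- The mixed partial derivative along the coordinates in `α`, scaled by `δ ^ #α`, of the map
`u ↦ 𝓕⁻ (ridgeSymbol h φ u) x`. It is taken in the direction variable `u`, not in `x`. -/
noncomputable def ridgeDeriv (h : EuclideanSpace ℝ ι → ℂ) (φ : ℝ → ℂ) (δ : ℝ) (α : Finset ι)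
    (u x : EuclideanSpace ℝ ι) : ℂ :=
  𝓕⁻ (ridgeSymbol (fun ζ => ((∏ i ∈ α, δ * ζ i : ℝ) : ℂ) * h ζ) (iteratedDeriv α.card φ) u) x

variable {h : EuclideanSpace ℝ ι → ℂ} {δ : ℝ}

theorem norm_prod_mul_le (hδ : 0 < δ) (hsupp : ∀ ζ, h ζ ≠ 0 → ‖ζ‖ ≤ δ⁻¹) (α : Finset ι)
    (ζ : EuclideanSpace ℝ ι) : ‖((∏ i ∈ α, δ * ζ i : ℝ) : ℂ) * h ζ‖ ≤ ‖h ζ‖ := by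
  by_cases hζ : h ζ = 0
  · simp [hζ]
  rw [norm_mul, Complex.norm_real, norm_prod]
  refine mul_le_of_le_one_left (norm_nonneg _) (Finset.prod_le_one (fun _ _ => norm_nonneg _)
    fun i _ => ?_)
  calc ‖δ * ζ i‖ = δ * ‖ζ i‖ := by rw [norm_mul, Real.norm_of_nonneg hδ.le]
    _ ≤ δ * δ⁻¹ := by gcongr; exact (PiLp.norm_apply_le ζ i).trans (hsupp ζ hζ)
    _ = 1 := mul_inv_cancel₀ hδ.ne'

theorem memLp_prod_mul {p : ℝ≥0∞} (hδ : 0 < δ) (hh : MemLp h p)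
    (hsupp : ∀ ζ, h ζ ≠ 0 → ‖ζ‖ ≤ δ⁻¹) (α : Finset ι) :
    MemLp (fun ζ => ((∏ i ∈ α, δ * ζ i : ℝ) : ℂ) * h ζ) p :=
  hh.of_le (AEStronglyMeasurable.mul (Continuous.aestronglyMeasurable (by fun_prop)) hh.1)
    (Filter.Eventually.of_forall (norm_prod_mul_le hδ hsupp α))

theorem integrable_prod_mul (hδ : 0 < δ) (hh : Integrable h)
    (hsupp : ∀ ζ, h ζ ≠ 0 → ‖ζ‖ ≤ δ⁻¹) (α : Finset ι) :
    Integrable fun ζ => ((∏ i ∈ α, δ * ζ i : ℝ) : ℂ) * h ζ :=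
  memLp_one_iff_integrable.1 (memLp_prod_mul hδ (memLp_one_iff_integrable.2 hh) hsupp α)

theorem continuous_ridgeDeriv (hδ : 0 < δ) (hh : Integrable h)
    (hsupp : ∀ ζ, h ζ ≠ 0 → ‖ζ‖ ≤ δ⁻¹) (hφ : ContDiff ℝ (Fintype.card ι) φ)
    (hb : ∀ n ≤ Fintype.card ι, ∀ s, ‖iteratedDeriv n φ s‖ ≤ b) (α : Finset ι) :
    Continuous (Function.uncurry (ridgeDeriv h φ δ α)) :=
  continuous_fourierInv_ridgeSymbol (integrable_prod_mul hδ hh hsupp α)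
    (hφ.continuous_iteratedDeriv _ (by exact_mod_cast α.card_le_univ)) (hb _ α.card_le_univ)

theorem hasDerivAt_ridgeDeriv [DecidableEq ι] (hδ : 0 < δ) (hh : Integrable h)
    (hsupp : ∀ ζ, h ζ ≠ 0 → ‖ζ‖ ≤ δ⁻¹) (hφ : ContDiff ℝ (Fintype.card ι) φ)
    (hb : ∀ n ≤ Fintype.card ι, ∀ s, ‖iteratedDeriv n φ s‖ ≤ b) {α : Finset ι} {i : ι}
    (hi : i ∉ α) (u : ι → ℝ) (x : EuclideanSpace ℝ ι) (t : ℝ) :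
    HasDerivAt (fun r => ridgeDeriv h φ δ α (WithLp.toLp 2 (Function.update u i r)) x)
      (δ⁻¹ • ridgeDeriv h φ δ (insert i α) (WithLp.toLp 2 (Function.update u i t)) x) t := by
  have hcard : α.card + 1 ≤ Fintype.card ι :=
    (Finset.card_insert_of_notMem hi).symm.trans_le (Finset.card_le_univ _)
  have hinsert : (fun ζ => (inner ℝ ζ (EuclideanSpace.single i (1 : ℝ)) : ℂ) *
      (((∏ j ∈ α, δ * ζ j : ℝ) : ℂ) * h ζ)) =
      fun ζ => (δ⁻¹ : ℂ) * (((∏ j ∈ insert i α, δ * ζ j : ℝ) : ℂ) * h ζ) := by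
    ext ζ
    rw [Finset.prod_insert hi, EuclideanSpace.inner_single_right]
    push_cast
    have : (δ : ℂ) ≠ 0 := by exact_mod_cast hδ.ne'
    simp only [conj_trivial, one_mul]
    field_simp
  have hγ : ∀ r, HasDerivAt (fun r => WithLp.toLp 2 (Function.update u i r))
      (EuclideanSpace.single i (1 : ℝ)) r := fun r =>
    (PiLp.continuousLinearEquiv 2 ℝ fun _ : ι => ℝ).symm.hasFDerivAt.comp_hasDerivAt r
      (hasDerivAt_update u i r)
  have hm : ContDiff ℝ 1 (iteratedDeriv α.card φ) := by
    rw [iteratedDeriv_eq_iterate]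
    exact ContDiff.iterate_deriv' 1 _ (hφ.of_le (by exact_mod_cast (by omega)))
  have hderiv := hasDerivAt_fourierInv_ridgeSymbol (integrable_prod_mul hδ hh hsupp α)
    (hinsert ▸ (integrable_prod_mul hδ hh hsupp (insert i α)).const_mul _) hm
    (hb _ α.card_le_univ)
    (fun s => by rw [← iteratedDeriv_succ]; exact hb _ hcard s) hγ x t
  refine hderiv.congr_deriv ?_
  rw [hinsert, ← iteratedDeriv_succ, ridgeDeriv, Finset.card_insert_of_notMem hi]
  simp only [Real.fourierInv_eq, ← integral_smul, ridgeSymbol]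
  congr with ζ
  simp [Circle.smul_def]
  ring

theorem lintegral_ridgeDeriv_sq_le (hδ : 0 < δ) (hh : Integrable h) (hh2 : MemLp h 2)
    (hsupp : ∀ ζ, h ζ ≠ 0 → ‖ζ‖ ≤ δ⁻¹) (hφ : ContDiff ℝ (Fintype.card ι) φ)
    (hb : ∀ n ≤ Fintype.card ι, ∀ s, ‖iteratedDeriv n φ s‖ ≤ b) (hR : ∀ s, φ s ≠ 0 → |s| ≤ R)
    (α : Finset ι) (u : EuclideanSpace ℝ ι) :
    ∫⁻ x, ‖ridgeDeriv h φ δ α u x‖ₑ ^ 2 ≤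
      ENNReal.ofReal b ^ 2 * ∫⁻ ζ in {ζ | |inner ℝ ζ u| ≤ R}, ‖h ζ‖ₑ ^ 2 := by
  refine (lintegral_fourierInv_ridgeSymbol_sq_le (integrable_prod_mul hδ hh hsupp α)
    (memLp_prod_mul hδ hh2 hsupp α)
    (hφ.continuous_iteratedDeriv _ (by exact_mod_cast α.card_le_univ)) (hb _ α.card_le_univ)
    (abs_le_of_iteratedDeriv_ne_zero hR α.card) u).trans ?_
  gcongr with ζ
  exact enorm_le_iff_norm_le.2 (norm_prod_mul_le hδ hsupp α ζ)

theorem enorm_sq_fourierInv_ridgeSymbol_le_lintegral_cube (hδ : 0 < δ)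
    (hh : Integrable h) (hsupp : ∀ ζ, h ζ ≠ 0 → ‖ζ‖ ≤ δ⁻¹) (hφ : ContDiff ℝ (Fintype.card ι) φ)
    (hb : ∀ n ≤ Fintype.card ι, ∀ s, ‖iteratedDeriv n φ s‖ ≤ b) (v x : EuclideanSpace ℝ ι) :
    ‖𝓕⁻ (ridgeSymbol h φ v) x‖ₑ ^ 2 ≤ ENNReal.ofReal (2 / δ) ^ Fintype.card ι *
      ∫⁻ u in {u : EuclideanSpace ℝ ι | ∀ i, u i ∈ Set.Icc (v i) (v i + δ)},
        ∑ α, ‖ridgeDeriv h φ δ α u x‖ₑ ^ 2 := by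
  classical
  let g : Finset ι → (ι → ℝ) → ℂ := fun α u => ridgeDeriv h φ δ α (WithLp.toLp 2 u) x
  have hg : ∀ α, Continuous (g α) := fun α =>
    ((continuous_ridgeDeriv hδ hh hsupp hφ hb α).uncurry_right x).comp
      (PiLp.continuous_toLp 2 _)
  have hcube := enorm_sq_le_lintegral_cube hδ hg
    (fun α i hi u t => hasDerivAt_ridgeDeriv hδ hh hsupp hφ hb hi u x t) v
  have hset : WithLp.toLp 2 ⁻¹' {u : EuclideanSpace ℝ ι | ∀ i, u i ∈ Set.Icc (v i) (v i + δ)} =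
      Set.Icc (v : ι → ℝ) fun i => v i + δ := by
    ext u
    simp [Pi.le_def, forall_and]
  rw [← (PiLp.volume_preserving_toLp ι).setLIntegral_comp_preimage_emb
    (MeasurableEquiv.toLp 2 (ι → ℝ)).measurableEmbedding, hset]
  simpa [g, ridgeDeriv] using hcube

theorem lintegral_iSup_fourierInv_ridgeSymbol_sq_le
    {V A : Set (EuclideanSpace ℝ ι)} (hδ : 0 < δ) (hh : Integrable h) (hh2 : MemLp h 2)
    (hsupp : ∀ ζ, h ζ ≠ 0 → ‖ζ‖ ≤ δ⁻¹) (hφ : ContDiff ℝ (Fintype.card ι) φ)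
    (hb : ∀ n ≤ Fintype.card ι, ∀ s, ‖iteratedDeriv n φ s‖ ≤ b) (hR : ∀ s, φ s ≠ 0 → |s| ≤ R)
    (hA : ∀ v ∈ V, ∀ u : EuclideanSpace ℝ ι, (∀ i, u i ∈ Set.Icc (v i) (v i + δ)) → u ∈ A) :
    ∫⁻ x, ⨆ v ∈ V, ‖𝓕⁻ (ridgeSymbol h φ v) x‖ₑ ^ 2 ≤
      ENNReal.ofReal (2 / δ) ^ Fintype.card ι * 2 ^ Fintype.card ι * ENNReal.ofReal b ^ 2 *
        ∫⁻ u in A, ∫⁻ ζ in {ζ | |inner ℝ ζ u| ≤ R}, ‖h ζ‖ₑ ^ 2 := by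
  let K := ENNReal.ofReal (2 / δ) ^ Fintype.card ι
  have hK : K ≠ ⊤ := by finiteness
  have hcont : ∀ α : Finset ι, Continuous (Function.uncurry (ridgeDeriv h φ δ α)) :=
    continuous_ridgeDeriv hδ hh hsupp hφ hb
  calc ∫⁻ x, ⨆ v ∈ V, ‖𝓕⁻ (ridgeSymbol h φ v) x‖ₑ ^ 2
      ≤ ∫⁻ x, K * ∫⁻ u in A, ∑ α, ‖ridgeDeriv h φ δ α u x‖ₑ ^ 2 :=
        lintegral_mono fun x => iSup₂_le fun v hv =>
          (enorm_sq_fourierInv_ridgeSymbol_le_lintegral_cube hδ hh hsupp hφ hb v x).trans <| by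
            gcongr
            exact hA v hv
    _ = K * ∫⁻ u in A, ∑ α, ∫⁻ x, ‖ridgeDeriv h φ δ α u x‖ₑ ^ 2 := by
        rw [lintegral_const_mul' _ _ hK, lintegral_lintegral_swap]
        · congr with u
          exact lintegral_finsetSum _ fun α _ =>
            ((hcont α).uncurry_left u).enorm.measurable.pow_const 2
        · exact (Finset.measurable_sum _ fun α _ =>
            ((hcont α).comp continuous_swap).enorm.measurable.pow_const 2).aemeasurable
    _ ≤ K * ∫⁻ u in A, ∑ _α : Finset ι, ENNReal.ofReal b ^ 2 *
          ∫⁻ ζ in {ζ | |inner ℝ ζ u| ≤ R}, ‖h ζ‖ₑ ^ 2 := by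
        gcongr with u α
        exact lintegral_ridgeDeriv_sq_le hδ hh hh2 hsupp hφ hb hR α u
    _ = _ := by
        simp only [Finset.sum_const, Finset.card_univ, Fintype.card_finset, nsmul_eq_mul]
        push_cast
        simp_rw [← mul_assoc]
        rw [lintegral_const_mul' _ _ (by finiteness)]
        simp only [K, mul_assoc]

end RidgeDeriv

section EquatorialBand

theorem volume_complex_annulus_le (A B : ℝ) :
    volume {z : ℂ | A ≤ ‖z‖ ^ 2 ∧ ‖z‖ ^ 2 ≤ B} ≤ ENNReal.ofReal (Real.pi * (B - A)) := by
  rcases lt_or_ge B A with hAB | hAB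
  · rw [show {z : ℂ | A ≤ ‖z‖ ^ 2 ∧ ‖z‖ ^ 2 ≤ B} = ∅ from
      Set.eq_empty_of_forall_notMem fun z hz => hAB.not_ge (hz.1.trans hz.2), measure_empty]
    exact zero_le
  have hsub : {z : ℂ | A ≤ ‖z‖ ^ 2 ∧ ‖z‖ ^ 2 ≤ B} ⊆
      Metric.closedBall 0 √B \ Metric.ball 0 √A := fun z hz =>
    ⟨mem_closedBall_zero_iff.2 (Real.le_sqrt_of_sq_le hz.2), fun hz' =>
      (Real.sqrt_le_iff.2 ⟨norm_nonneg _, hz.1⟩).not_gt (mem_ball_zero_iff.1 hz')⟩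
  have hsqrt : ∀ x, ENNReal.ofReal √x ^ 2 = ENNReal.ofReal x := fun x => by
    rw [← ENNReal.ofReal_pow (Real.sqrt_nonneg x)]
    rcases le_total 0 x with hx | hx
    · rw [Real.sq_sqrt hx]
    · simp [Real.sqrt_eq_zero_of_nonpos hx, ENNReal.ofReal_of_nonpos hx]
  refine (measure_mono hsub).trans ?_
  rw [measure_sdiff (Metric.ball_subset_closedBall.trans
      (Metric.closedBall_subset_closedBall (Real.sqrt_le_sqrt hAB)))
    measurableSet_ball.nullMeasurableSet measure_ball_lt_top.ne, Complex.volume_closedBall,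
    Complex.volume_ball, hsqrt, hsqrt, ← ENNReal.sub_mul fun _ _ => ENNReal.coe_ne_top,
    ENNReal.ofReal_mul Real.pi_pos.le, mul_comm, ← NNReal.coe_real_pi, ENNReal.ofReal_coe_nnreal]
  gcongr
  rw [tsub_le_iff_right]
  simpa using ENNReal.ofReal_add_le (p := B - A) (q := A)

/-- The point of `ℝ³` with the given coordinate along the first axis and the given projection to
the plane of the other two, which is identified with `ℂ`. -/
def ofAxial (p : ℝ × ℂ) : R3 := !₂[p.1, p.2.re, p.2.im]

theorem norm_ofAxial_sq (p : ℝ × ℂ) : ‖ofAxial p‖ ^ 2 = p.1 ^ 2 + ‖p.2‖ ^ 2 := by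
  simp [ofAxial, EuclideanSpace.norm_sq_eq, Fin.sum_univ_three, Complex.sq_norm,
    Complex.normSq_apply]
  ring

theorem measurePreserving_ofAxial : MeasurePreserving ofAxial := by
  have hplane : MeasurePreserving (Prod.map id Complex.measurableEquivPi)
      (volume : Measure (ℝ × ℂ)) (volume : Measure (ℝ × (Fin 2 → ℝ))) :=
    (MeasurePreserving.id volume).prod Complex.volume_preserving_equiv_pi
  have haxis := (volume_preserving_piFinSuccAbove (fun _ : Fin 3 => ℝ) 0).symm
  have hcomp : ofAxial =
      (WithLp.toLp 2 ∘ (MeasurableEquiv.piFinSuccAbove (fun _ : Fin 3 => ℝ) 0).symm) ∘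
        Prod.map id Complex.measurableEquivPi := by
    ext p i
    fin_cases i <;> rfl
  rw [hcomp]
  exact ((PiLp.volume_preserving_toLp (Fin 3)).comp haxis).comp hplane

/-- The part of a neighbourhood of the unit sphere in a neighbourhood of the plane orthogonal to
`ζ`. -/
def equatorialBand (ζ : R3) (τ ρ : ℝ) : Set R3 :=
  {u | |‖u‖ ^ 2 - 1| ≤ τ ∧ |inner ℝ ζ u| ≤ ρ * ‖ζ‖}

variable {ζ : R3} {τ ρ r σ : ℝ}

theorem measurableSet_equatorialBand : MeasurableSet (equatorialBand ζ τ ρ) := by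
  have hshell : MeasurableSet {u : R3 | |‖u‖ ^ 2 - 1| ≤ τ} :=
    measurableSet_le (by fun_prop) (by fun_prop)
  have hslab : MeasurableSet {u : R3 | |inner ℝ ζ u| ≤ ρ * ‖ζ‖} :=
    measurableSet_le (by fun_prop) (by fun_prop)
  exact hshell.inter hslab

theorem volume_equatorialBand_axis_le {a : ℝ} (ha : 0 < a) (hρ : 0 ≤ ρ) :
    volume (equatorialBand (EuclideanSpace.single 0 a) τ ρ) ≤
      ENNReal.ofReal (4 * Real.pi * ρ * τ) := by
  let Z : ℝ → Set ℂ := fun s => {z | 1 - s ^ 2 - τ ≤ ‖z‖ ^ 2 ∧ ‖z‖ ^ 2 ≤ 1 - s ^ 2 + τ}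
  have hslice : ∀ s z, ofAxial (s, z) ∈ equatorialBand (EuclideanSpace.single 0 a) τ ρ →
      s ∈ Set.Icc (-ρ) ρ ∧ z ∈ Z s := by
    rintro s z ⟨hnorm, hinner⟩
    rw [norm_ofAxial_sq, abs_le] at hnorm
    rw [EuclideanSpace.inner_single_left, PiLp.norm_single, abs_mul, mul_comm] at hinner
    exact ⟨abs_le.1 (le_of_mul_le_mul_right hinner (by simpa using ha.ne')),
      by linarith, by linarith⟩
  rw [← measurePreserving_ofAxial.measure_preimage measurableSet_equatorialBand.nullMeasurableSet,
    Measure.volume_eq_prod, Measure.prod_apply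
      (measurePreserving_ofAxial.measurable measurableSet_equatorialBand)]
  calc _ ≤ ∫⁻ s, (Set.Icc (-ρ) ρ).indicator (fun _ => ENNReal.ofReal (2 * Real.pi * τ)) s := by
        refine lintegral_mono fun s => ?_
        by_cases hs : s ∈ Set.Icc (-ρ) ρ
        · rw [Set.indicator_of_mem hs]
          refine (measure_mono fun z hz => (hslice s z hz).2).trans
            ((volume_complex_annulus_le _ _).trans_eq ?_)
          congr 1
          ring
        · rw [Set.indicator_of_notMem hs, nonpos_iff_eq_zero]
          exact measure_mono_null (fun z hz => hs (hslice s z hz).1) measure_empty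
    _ = ENNReal.ofReal (4 * Real.pi * ρ * τ) := by
        rw [lintegral_indicator_const measurableSet_Icc, Real.volume_Icc,
          ← ENNReal.ofReal_mul' (by linarith)]
        congr 1
        ring

theorem volume_equatorialBand_le (hζ : ζ ≠ 0) (hρ : 0 ≤ ρ) :
    volume (equatorialBand ζ τ ρ) ≤ ENNReal.ofReal (4 * Real.pi * ρ * τ) := by
  let e : R3 := EuclideanSpace.single 0 ‖ζ‖
  let rot := (ℝ ∙ (ζ - e))ᗮ.reflection
  have hrot : rot ζ = e := Submodule.reflection_sub (by simp [e])
  have hpre : rot ⁻¹' equatorialBand e τ ρ = equatorialBand ζ τ ρ := by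
    ext u
    simp only [equatorialBand, Set.mem_preimage, Set.mem_ofPred_eq, rot.norm_map, ← hrot,
      rot.inner_map_map]
  rw [← hpre, rot.measurePreserving.measure_preimage
    measurableSet_equatorialBand.nullMeasurableSet]
  exact volume_equatorialBand_axis_le (norm_pos_iff.2 hζ) hρ

theorem abs_norm_sq_sub_one_le {E : Type*} [NormedAddCommGroup E] {u v : E} (hv : ‖v‖ = 1)
    (huv : ‖u - v‖ ≤ r) : |‖u‖ ^ 2 - 1| ≤ r * (2 + r) := by
  have hu : |‖u‖ - 1| ≤ r := hv ▸ (abs_norm_sub_norm_le u v).trans huv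
  rw [show ‖u‖ ^ 2 - 1 = (‖u‖ - 1) * (‖u‖ + 1) by ring, abs_mul,
    abs_of_nonneg (by positivity : 0 ≤ ‖u‖ + 1)]
  exact mul_le_mul hu (by linarith [(abs_le.1 hu).2]) (by positivity) ((abs_nonneg _).trans hu)

theorem closedBall_subset_equatorialBand {v : R3} (hv : ‖v‖ = 1)
    (hvζ : |inner ℝ ζ v| ≤ σ * ‖ζ‖) :
    Metric.closedBall v r ⊆ equatorialBand ζ (r * (2 + r)) (σ + r) := by
  intro u hu
  have huv : ‖u - v‖ ≤ r := mem_closedBall_iff_norm.1 hu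
  refine ⟨abs_norm_sq_sub_one_le hv huv, ?_⟩
  calc |inner ℝ ζ u| = |inner ℝ ζ v + inner ℝ ζ (u - v)| := by
        rw [← inner_add_right, add_sub_cancel]
    _ ≤ |inner ℝ ζ v| + |inner ℝ ζ (u - v)| := abs_add_le _ _
    _ ≤ σ * ‖ζ‖ + ‖ζ‖ * r :=
        add_le_add hvζ ((abs_real_inner_le_norm _ _).trans (by gcongr))
    _ = (σ + r) * ‖ζ‖ := by ring

theorem card_le_of_separated_of_abs_inner_le (hr : 0 < r) (hσ : 0 ≤ σ) (hζ : ζ ≠ 0) {T : Finset R3}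
    (hT : ∀ v ∈ T, ‖v‖ = 1) (hsep : (T : Set R3).Pairwise fun v w => 2 * r ≤ ‖v - w‖)
    (hslab : ∀ v ∈ T, |inner ℝ ζ v| ≤ σ * ‖ζ‖) :
    (T.card : ℝ) ≤ 3 * (σ + r) * (2 + r) / r ^ 2 := by
  have hsub : (⋃ v ∈ T, Metric.ball v r) ⊆ equatorialBand ζ (r * (2 + r)) (σ + r) :=
    Set.iUnion₂_subset fun v hv => Metric.ball_subset_closedBall.trans
      (closedBall_subset_equatorialBand (hT v hv) (hslab v hv))
  have hdisj : (T : Set R3).PairwiseDisjoint fun v => Metric.ball v r := fun v hv w hw hvw =>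
    Metric.ball_disjoint_ball (by linarith [hsep hv hw hvw, dist_eq_norm v w])
  have hvol := (measure_mono hsub).trans (volume_equatorialBand_le hζ (by positivity))
  rw [measure_biUnion_finset hdisj fun v _ => measurableSet_ball] at hvol
  simp only [EuclideanSpace.volume_ball_fin_three, Finset.sum_const, nsmul_eq_mul,
    ← ENNReal.ofReal_pow hr.le, ← ENNReal.ofReal_natCast (n := T.card)] at hvol
  rw [← ENNReal.ofReal_mul (by positivity), ← ENNReal.ofReal_mul (by positivity),
    ENNReal.ofReal_le_ofReal_iff (by positivity)] at hvol
  rw [le_div_iff₀ (by positivity)]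
  refine le_of_mul_le_mul_right (a := 4 / 3 * Real.pi * r) ?_ (by positivity)
  linarith

end EquatorialBand

section MaximalEstimate

/-- A frequency profile at scale `ε⁻¹`: it lives at frequencies `‖ζ‖ ≤ ε⁻¹`, and the directions
`u` near the unit sphere with `|⟪ζ, u⟫| ≤ R` are within `3 * ε` of the plane orthogonal to `ζ`. -/
structure IsFrequencyProfile (R ε : ℝ) (h : R3 → ℂ) : Prop where
  integrable : Integrable h
  memLp_two : MemLp h 2
  norm_le : ∀ ζ, h ζ ≠ 0 → ‖ζ‖ ≤ ε⁻¹
  ne_zero : ∀ ζ, h ζ ≠ 0 → ζ ≠ 0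
  abs_inner_le : ∀ ζ, h ζ ≠ 0 → ∀ u, ‖u‖ ≤ 3 → |inner ℝ ζ u| ≤ R →
    |inner ℝ ζ u| ≤ 3 * ε * ‖ζ‖

theorem norm_sub_le_of_mem_cube {ι : Type*} [Fintype ι] {u v : EuclideanSpace ℝ ι} {δ : ℝ}
    (hδ : 0 ≤ δ) (hu : ∀ i, u i ∈ Set.Icc (v i) (v i + δ)) :
    ‖u - v‖ ≤ √(Fintype.card ι) * δ := by
  rw [EuclideanSpace.norm_eq, ← Real.sqrt_sq hδ, ← Real.sqrt_mul (Nat.cast_nonneg _)]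
  refine Real.sqrt_le_sqrt ((Finset.sum_le_card_nsmul _ _ (δ ^ 2) fun i _ => ?_).trans_eq ?_)
  · rw [Real.norm_eq_abs, sq_abs, PiLp.sub_apply]
    exact pow_le_pow_left₀ (by linarith [(hu i).1]) (by linarith [(hu i).2]) 2
  · rw [Finset.card_univ, nsmul_eq_mul]

variable {h : R3 → ℂ} {φ : ℝ → ℂ} {R ε b : ℝ}

theorem lintegral_iSup_sphere_le (hε : 0 < ε) (hε1 : ε ≤ 1) (hh : IsFrequencyProfile R ε h)
    (hφ : ContDiff ℝ 3 φ) (hb : ∀ n ≤ 3, ∀ s, ‖iteratedDeriv n φ s‖ ≤ b)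
    (hR : ∀ s, φ s ≠ 0 → |s| ≤ R) :
    ∫⁻ x, ⨆ v ∈ Metric.sphere (0 : R3) 1, ‖𝓕⁻ (ridgeSymbol h φ v) x‖ₑ ^ 2 ≤
      ENNReal.ofReal (6144 * Real.pi * b ^ 2 / ε) * ∫⁻ ζ, ‖h ζ‖ₑ ^ 2 := by
  let A : Set R3 := {u | |‖u‖ ^ 2 - 1| ≤ 8 * ε}
  have hcube : ∀ v ∈ Metric.sphere (0 : R3) 1, ∀ u : R3,
      (∀ i, u i ∈ Set.Icc (v i) (v i + ε)) → u ∈ A := fun v hv u hu => by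
    have hsqrt : √(Fintype.card (Fin 3)) ≤ 2 := Real.sqrt_le_iff.2 (by norm_num)
    have huv : ‖u - v‖ ≤ 2 * ε := (norm_sub_le_of_mem_cube hε.le hu).trans (by gcongr)
    refine (abs_norm_sq_sub_one_le (mem_sphere_zero_iff_norm.1 hv) huv).trans ?_
    nlinarith
  have hband : ∀ ζ, h ζ ≠ 0 → volume.restrict A {u | |inner ℝ ζ u| ≤ R} ≤
      ENNReal.ofReal (4 * Real.pi * (3 * ε) * (8 * ε)) := fun ζ hζ => by
    rw [Measure.restrict_apply (measurableSet_le (by fun_prop) (by fun_prop))]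
    have hnorm : ∀ u ∈ A, ‖u‖ ≤ 3 := fun u hu =>
      le_of_sq_le_sq (by linarith [(abs_le.1 hu.out).2]) (by norm_num)
    have hsub : {u | |inner ℝ ζ u| ≤ R} ∩ A ⊆ equatorialBand ζ (8 * ε) (3 * ε) :=
      fun u hu => ⟨hu.2, hh.abs_inner_le ζ hζ u (hnorm u hu.2) hu.1⟩
    exact (measure_mono hsub).trans
      (volume_equatorialBand_le (hh.ne_zero ζ hζ) (by positivity))
  calc _ ≤ ENNReal.ofReal (2 / ε) ^ 3 * 2 ^ 3 * ENNReal.ofReal b ^ 2 *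
          ∫⁻ u in A, ∫⁻ ζ in {ζ | |inner ℝ ζ u| ≤ R}, ‖h ζ‖ₑ ^ 2 :=
        lintegral_iSup_fourierInv_ridgeSymbol_sq_le hε hh.integrable hh.memLp_two hh.norm_le
          hφ hb hR hcube
    _ ≤ ENNReal.ofReal (2 / ε) ^ 3 * 2 ^ 3 * ENNReal.ofReal b ^ 2 *
          (ENNReal.ofReal (4 * Real.pi * (3 * ε) * (8 * ε)) * ∫⁻ ζ, ‖h ζ‖ₑ ^ 2) := by
        gcongr
        exact lintegral_setLIntegral_slab_le hh.integrable.1 hband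
    _ = _ := by
        have hb0 : 0 ≤ b := (norm_nonneg _).trans (hb 0 (by norm_num) 0)
        rw [← ENNReal.ofReal_pow (by positivity), ← ENNReal.ofReal_pow hb0,
          show (2 : ℝ≥0∞) ^ 3 = ENNReal.ofReal 8 by norm_num,
          ← ENNReal.ofReal_mul (by positivity), ← ENNReal.ofReal_mul (by positivity), ← mul_assoc,
          ← ENNReal.ofReal_mul (by positivity)]
        congr 2
        field_simp
        ring

variable {S : Finset R3} {c ρ : ℝ}

theorem card_filter_abs_inner_le (hερ : ε ≤ ρ) (hρ : 0 < ρ) (hρ1 : ρ ≤ 1) (hc : 0 < c)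
    (hS : ∀ v ∈ S, ‖v‖ = 1) (hsep : ∀ v ∈ S, ∀ w ∈ S, v ≠ w → c * ρ ≤ ‖v - w‖)
    (hh : IsFrequencyProfile R ε h) {ζ : R3} (hζ : h ζ ≠ 0) :
    ((S.filter fun v => |inner ℝ ζ v| ≤ R).card : ℝ) ≤
      12 * (3 + c / 2) * (2 + c / 2) / c ^ 2 / ρ := by
  have hcard := card_le_of_separated_of_abs_inner_le (r := c * ρ / 2) (σ := 3 * ρ)
    (T := S.filter fun v => |inner ℝ ζ v| ≤ R) (by positivity) (by positivity) (hh.ne_zero ζ hζ)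
    (fun v hv => hS v (Finset.mem_filter.1 hv).1)
    (fun v hv w hw hvw => by
      linarith [hsep v (Finset.mem_filter.1 hv).1 w (Finset.mem_filter.1 hw).1 hvw])
    (fun v hv => by
      obtain ⟨hvS, hvR⟩ := Finset.mem_filter.1 hv
      refine (hh.abs_inner_le ζ hζ v (by norm_num [hS v hvS]) hvR).trans ?_
      gcongr)
  calc _ ≤ 3 * (3 * ρ + c * ρ / 2) * (2 + c * ρ / 2) / (c * ρ / 2) ^ 2 := hcard
    _ = 12 * (3 + c / 2) * (2 + c * ρ / 2) / c ^ 2 / ρ := by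
        field_simp
        ring
    _ ≤ _ := by
        gcongr
        exact mul_le_of_le_one_right hc.le hρ1

theorem lintegral_iSup_finset_le (hερ : ε ≤ ρ) (hρ : 0 < ρ) (hρ1 : ρ ≤ 1)
    (hc : 0 < c) (hS : ∀ v ∈ S, ‖v‖ = 1)
    (hsep : ∀ v ∈ S, ∀ w ∈ S, v ≠ w → c * ρ ≤ ‖v - w‖) (hh : IsFrequencyProfile R ε h)
    (hφ : Continuous φ) (hb : ∀ s, ‖φ s‖ ≤ b) (hR : ∀ s, φ s ≠ 0 → |s| ≤ R) :
    ∫⁻ x, ⨆ v ∈ S, ‖𝓕⁻ (ridgeSymbol h φ v) x‖ₑ ^ 2 ≤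
      ENNReal.ofReal (b ^ 2 * (12 * (3 + c / 2) * (2 + c / 2) / c ^ 2 / ρ)) *
        ∫⁻ ζ, ‖h ζ‖ₑ ^ 2 := by
  let ν : Measure R3 := Measure.count.restrict S
  have : IsFiniteMeasure ν := ⟨by
    rw [Measure.restrict_apply_univ, Measure.count_apply_finset]
    exact ENNReal.natCast_lt_top _⟩
  have hcount : ∀ ζ, h ζ ≠ 0 → ν {u | |inner ℝ ζ u| ≤ R} ≤
      ENNReal.ofReal (12 * (3 + c / 2) * (2 + c / 2) / c ^ 2 / ρ) := fun ζ hζ => by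
    rw [Measure.restrict_apply' S.measurableSet,
      show {u | |inner ℝ ζ u| ≤ R} ∩ (S : Set R3) =
        (S.filter fun v => |inner ℝ ζ v| ≤ R : Finset R3) by ext; simp [and_comm],
      Measure.count_apply_finset, ← ENNReal.ofReal_natCast]
    exact ENNReal.ofReal_le_ofReal
      (card_filter_abs_inner_le hερ hρ hρ1 hc hS hsep hh hζ)
  calc ∫⁻ x, ⨆ v ∈ S, ‖𝓕⁻ (ridgeSymbol h φ v) x‖ₑ ^ 2
    _ ≤ ∫⁻ x, ∑ v ∈ S, ‖𝓕⁻ (ridgeSymbol h φ v) x‖ₑ ^ 2 :=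
        lintegral_mono fun x => iSup₂_le fun v hv =>
          Finset.single_le_sum (f := fun v => ‖𝓕⁻ (ridgeSymbol h φ v) x‖ₑ ^ 2)
            (fun _ _ => zero_le) hv
    _ = ∑ v ∈ S, ∫⁻ x, ‖𝓕⁻ (ridgeSymbol h φ v) x‖ₑ ^ 2 :=
        lintegral_finsetSum _ fun v _ => (continuous_fourierInv
          (integrable_ridgeSymbol hh.integrable hφ hb v)).enorm.measurable.pow_const 2
    _ ≤ ∑ v ∈ S, ENNReal.ofReal b ^ 2 * ∫⁻ ζ in {ζ | |inner ℝ ζ v| ≤ R}, ‖h ζ‖ₑ ^ 2 :=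
        Finset.sum_le_sum fun v _ =>
          lintegral_fourierInv_ridgeSymbol_sq_le hh.integrable hh.memLp_two hφ hb hR v
    _ = ENNReal.ofReal b ^ 2 * ∫⁻ v, (∫⁻ ζ in {ζ | |inner ℝ ζ v| ≤ R}, ‖h ζ‖ₑ ^ 2) ∂ν := by
        simp_rw [← Finset.mul_sum, ν, lintegral_finset, Measure.count_singleton, mul_one]
    _ ≤ ENNReal.ofReal b ^ 2 *
          (ENNReal.ofReal (12 * (3 + c / 2) * (2 + c / 2) / c ^ 2 / ρ) * ∫⁻ ζ, ‖h ζ‖ₑ ^ 2) := by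
        gcongr
        exact lintegral_setLIntegral_slab_le hh.integrable.1 hcount
    _ = _ := by
        rw [← mul_assoc, ← ENNReal.ofReal_pow ((norm_nonneg _).trans (hb 0)),
          ← ENNReal.ofReal_mul (by positivity)]

theorem lintegral_iSup_separated_le (hε : 0 < ε) (hε1 : ε ≤ 1) (hρ : 0 < ρ) (hρ1 : ρ ≤ 1)
    (hc : 0 < c) (hS : ∀ v ∈ S, ‖v‖ = 1)
    (hsep : ∀ v ∈ S, ∀ w ∈ S, v ≠ w → c * ρ ≤ ‖v - w‖) (hh : IsFrequencyProfile R ε h)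
    (hφ : ContDiff ℝ 3 φ) (hb : ∀ n ≤ 3, ∀ s, ‖iteratedDeriv n φ s‖ ≤ b)
    (hR : ∀ s, φ s ≠ 0 → |s| ≤ R) :
    ∫⁻ x, ⨆ v ∈ S, ‖𝓕⁻ (ridgeSymbol h φ v) x‖ₑ ^ 2 ≤
      ENNReal.ofReal (b ^ 2 * (6144 * Real.pi + 12 * (3 + c / 2) * (2 + c / 2) / c ^ 2) / ρ) *
        ∫⁻ ζ, ‖h ζ‖ₑ ^ 2 := by
  rcases le_total ε ρ with hερ | hρε
  · refine (lintegral_iSup_finset_le hερ hρ hρ1 hc hS hsep hh hφ.continuous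
      (by simpa using hb 0 (by norm_num)) hR).trans ?_
    rw [mul_div_assoc (b ^ 2)]
    gcongr
    exact le_add_of_nonneg_left (by positivity)
  · calc ∫⁻ x, ⨆ v ∈ S, ‖𝓕⁻ (ridgeSymbol h φ v) x‖ₑ ^ 2
      _ ≤ ∫⁻ x, ⨆ v ∈ Metric.sphere (0 : R3) 1, ‖𝓕⁻ (ridgeSymbol h φ v) x‖ₑ ^ 2 :=
          lintegral_mono fun x => biSup_mono fun v hv => mem_sphere_zero_iff_norm.2 (hS v hv)
      _ ≤ _ := lintegral_iSup_sphere_le hε hε1 hh hφ hb hR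
      _ ≤ _ := by
          rw [mul_comm (_ * _) (b ^ 2)]
          gcongr
          exact le_add_of_nonneg_right (by positivity)

end MaximalEstimate

section Averages

/-- The symbol `s ↦ ∫ t, e^{2πist} ψ t` by which averaging along a line acts on frequencies. -/
noncomputable def averageSymbol (ψ : SchwartzMap ℝ ℝ) : SchwartzMap ℝ ℂ :=
  𝓕⁻ (ψ.postcompCLM Complex.ofRealCLM)

theorem averageSymbol_apply (ψ : SchwartzMap ℝ ℝ) (s : ℝ) :
    averageSymbol ψ s = ∫ t : ℝ, (Real.fourierChar (t * s) : ℂ) * (ψ t : ℂ) := by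
  rw [averageSymbol, SchwartzMap.fourierInv_coe, Real.fourierInv_eq]
  refine integral_congr_ae (Filter.Eventually.of_forall fun t => ?_)
  simp [Circle.smul_def, mul_comm]

theorem angularFourier_neg_two_pi_mul (ψ : SchwartzMap ℝ ℝ) (s : ℝ) :
    angularFourier ψ (-(2 * Real.pi * s)) = averageSymbol ψ s := by
  rw [averageSymbol_apply, angularFourier]
  refine integral_congr_ae (Filter.Eventually.of_forall fun t => ?_)
  simp only [Real.fourierChar_apply]
  congr 2
  push_cast
  ring

theorem abs_le_of_averageSymbol_ne_zero {ψ : SchwartzMap ℝ ℝ}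
    (hψ : Function.support (angularFourier ψ) ⊆ Set.Icc (-1 : ℝ) 1) {s : ℝ}
    (hs : averageSymbol ψ s ≠ 0) : |s| ≤ (2 * Real.pi)⁻¹ := by
  rw [← angularFourier_neg_two_pi_mul] at hs
  have hsupp : |2 * Real.pi * s| ≤ 1 := by
    rw [← abs_neg]
    exact abs_le.2 (hψ hs)
  rwa [abs_mul, abs_of_pos Real.two_pi_pos, ← le_div_iff₀' Real.two_pi_pos, one_div] at hsupp

theorem exists_norm_iteratedDeriv_le {F : Type*} [NormedAddCommGroup F] [NormedSpace ℝ F]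
    (f : SchwartzMap ℝ F) (N : ℕ) : ∃ b > 0, ∀ n ≤ N, ∀ s, ‖iteratedDeriv n f s‖ ≤ b :=
  ⟨max _ 1, by positivity, fun n hn s => le_max_of_le_left <| by
    simpa [norm_iteratedFDeriv_eq_norm_iteratedDeriv] using
      f.one_add_le_sup_seminorm_apply (𝕜 := ℝ) (m := (0, N)) (k := 0) le_rfl hn s⟩

theorem directionalAverage_fourierInv (ψ : SchwartzMap ℝ ℝ) {h : R3 → ℂ} (hh : Integrable h)
    (v x : R3) :
    directionalAverage ψ v (𝓕⁻ h) x = 𝓕⁻ (ridgeSymbol h (averageSymbol ψ) v) x := by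
  have hint : Integrable (fun p : ℝ × R3 =>
      (Real.fourierChar (inner ℝ p.2 (x + p.1 • v)) : ℂ) * ((ψ p.1 : ℂ) * h p.2))
      ((volume : Measure ℝ).prod volume) := by
    have hc : Continuous fun p : ℝ × R3 =>
        (Real.fourierChar (inner ℝ p.2 (x + p.1 • v)) : ℂ) := by
      have := Real.continuous_fourierChar
      fun_prop
    exact (ψ.integrable.ofReal.mul_prod hh).bdd_mul (c := 1) hc.aestronglyMeasurable
      (Filter.Eventually.of_forall fun p => (Circle.norm_coe _).le)
  calc directionalAverage ψ v (𝓕⁻ h) x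
      = ∫ t : ℝ, ∫ ζ : R3,
          (Real.fourierChar (inner ℝ ζ (x + t • v)) : ℂ) * ((ψ t : ℂ) * h ζ) := by
        refine integral_congr_ae (Filter.Eventually.of_forall fun t => ?_)
        simp only [Real.fourierInv_eq, Circle.smul_def, smul_eq_mul]
        rw [← integral_mul_const]
        refine integral_congr_ae (Filter.Eventually.of_forall fun ζ => ?_)
        ring
    _ = ∫ ζ : R3, ∫ t : ℝ,
          (Real.fourierChar (inner ℝ ζ (x + t • v)) : ℂ) * ((ψ t : ℂ) * h ζ) :=
        integral_integral_swap hint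
    _ = 𝓕⁻ (ridgeSymbol h (averageSymbol ψ) v) x := by
        rw [Real.fourierInv_eq]
        refine integral_congr_ae (Filter.Eventually.of_forall fun ζ => ?_)
        simp only [ridgeSymbol, Circle.smul_def, smul_eq_mul, averageSymbol_apply]
        rw [← mul_assoc, ← integral_const_mul]
        refine integral_congr_ae (Filter.Eventually.of_forall fun t => ?_)
        simp only [inner_add_right, inner_smul_right, AddChar.map_add_eq_mul, Circle.coe_mul]
        ring

theorem integrable_fourierInv_line_mul {E : Type*} [NormedAddCommGroup E] [InnerProductSpace ℝ E]
    [FiniteDimensional ℝ E] [MeasurableSpace E] [BorelSpace E] {f : ℝ → ℂ} {h : E → ℂ}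
    (hf : Integrable f) (hh : Integrable h) (v x : E) :
    Integrable fun t : ℝ => 𝓕⁻ h (x + t • v) * f t := by
  have hc := continuous_fourierInv hh
  exact hf.bdd_mul (c := ∫ ζ, ‖h ζ‖) (Continuous.aestronglyMeasurable (by fun_prop))
    (Filter.Eventually.of_forall fun t =>
      VectorFourier.norm_fourierIntegral_le_integral_norm _ _ _ _ _)

theorem ae_ae_line {E : Type*} [NormedAddCommGroup E] [NormedSpace ℝ E] [MeasurableSpace E]
    [BorelSpace E] [SecondCountableTopology E] {ν : Measure E} [SFinite ν]
    [ν.IsAddRightInvariant] {P : E → Prop} (hP : ∀ᵐ x ∂ν, P x) (v : E) :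
    ∀ᵐ x ∂ν, ∀ᵐ t : ℝ, P (x + t • v) := by
  have hline : Measure.QuasiMeasurePreserving (fun p : E × ℝ => p.1 + p.2 • v)
      (ν.prod volume) ν :=
    QuasiMeasurePreserving.prod_of_left (by fun_prop) (Filter.Eventually.of_forall fun t =>
      (measurePreserving_add_right ν (t • v)).quasiMeasurePreserving)
  exact Measure.ae_ae_of_ae_prod (hline.ae hP)

theorem directionalMax_congr_ae (ψ : ℝ → ℝ) (S : Finset R3) {G G' : R3 → ℂ}
    (hG : G =ᵐ[volume] G') : directionalMax ψ S G =ᵐ[volume] directionalMax ψ S G' := by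
  filter_upwards [(ae_ball_iff S.countable_toSet).2 fun v _ => ae_ae_line hG v] with x hx
  rw [directionalMax, directionalMax, NNReal.coe_inj]
  refine Finset.sup_congr rfl fun v hv => congrArg nnnorm (integral_congr_ae ?_)
  filter_upwards [hx v hv] with t ht
  rw [ht]

theorem enorm_sq_directionalMax (ψ : ℝ → ℝ) (S : Finset R3) (G : R3 → ℂ) (x : R3) :
    ‖directionalMax ψ S G x‖ₑ ^ 2 = ⨆ v ∈ S, ‖directionalAverage ψ v G x‖ₑ ^ 2 := by
  rw [directionalMax, Real.enorm_of_nonneg NNReal.zero_le_coe, ENNReal.ofReal_coe_nnreal,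
    ENNReal.coe_finset_sup, Finset.apply_sup_eq_sup_comp_of_linearOrder (· ^ 2) (pow_left_mono 2)
      (zero_pow two_ne_zero), Finset.sup_eq_iSup]
  rfl

theorem continuous_directionalMax_fourierInv (ψ : SchwartzMap ℝ ℝ) (S : Finset R3) {h : R3 → ℂ}
    (hh : Integrable h) : Continuous (directionalMax ψ S (𝓕⁻ h)) := by
  refine NNReal.continuous_coe.comp (Continuous.finset_sup_apply fun v _ => ?_)
  simp_rw [directionalAverage_fourierInv ψ hh]
  exact (continuous_fourierInv (integrable_ridgeSymbol hh (averageSymbol ψ).continuous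
    (averageSymbol ψ).toBoundedContinuousFunction.norm_coe_le_norm v)).nnnorm

end Averages

section LocalizedSpectrum

/-- The Fourier transform of `freqLocalize μ k F`, in the variable `ζ = ξ / (2π)`. -/
noncomputable def DyadicCutoff.localizedSpectrum (μ : DyadicCutoff) (k : ℤ)
    (F : Lp ℂ 2 (volume : Measure R3)) (ζ : R3) : ℂ :=
  μ.dilate k ((2 * Real.pi) • ζ) * (𝓕 F : Lp ℂ 2 volume) ζ

variable (μ : DyadicCutoff) (k : ℤ) (F : Lp ℂ 2 (volume : Measure R3))

theorem DyadicCutoff.norm_mem_Icc_of_dilate_ne_zero {ξ : R3} (hξ : μ.dilate k ξ ≠ 0) :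
    ‖ξ‖ ∈ Set.Icc ((2 : ℝ) ^ k / 2) (2 * 2 ^ k) := by
  obtain ⟨hlower, hupper⟩ := μ.support_subset (Function.mem_support.2 hξ)
  rw [norm_smul, Real.norm_of_nonneg (by positivity), zpow_neg] at hlower hupper
  norm_num at hlower hupper
  rw [le_inv_mul_iff₀ (by positivity)] at hlower
  rw [inv_mul_le_iff₀ (by positivity)] at hupper
  exact ⟨by linarith, by linarith⟩

theorem DyadicCutoff.norm_mem_Icc_of_localizedSpectrum_ne_zero {ζ : R3}
    (hζ : μ.localizedSpectrum k F ζ ≠ 0) :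
    2 * Real.pi * ‖ζ‖ ∈ Set.Icc ((2 : ℝ) ^ k / 2) (2 * 2 ^ k) := by
  have hnorm := μ.norm_mem_Icc_of_dilate_ne_zero k (left_ne_zero_of_mul hζ)
  rwa [norm_smul, Real.norm_of_nonneg Real.two_pi_pos.le] at hnorm

theorem DyadicCutoff.memLp_localizedSpectrum : MemLp (μ.localizedSpectrum k F) 2 :=
  μ.memLp_dilate_mul k (𝓕 F)

theorem DyadicCutoff.norm_le_of_localizedSpectrum_ne_zero {ζ : R3}
    (hζ : μ.localizedSpectrum k F ζ ≠ 0) : ‖ζ‖ ≤ 2 ^ k := by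
  nlinarith [(μ.norm_mem_Icc_of_localizedSpectrum_ne_zero k F hζ).2, Real.pi_gt_three,
    norm_nonneg ζ]

theorem DyadicCutoff.integrable_localizedSpectrum : Integrable (μ.localizedSpectrum k F) := by
  have hsupp : Function.support (μ.localizedSpectrum k F) ⊆ Metric.closedBall 0 (2 ^ k) :=
    fun ζ hζ => mem_closedBall_zero_iff.2 (μ.norm_le_of_localizedSpectrum_ne_zero k F hζ)
  have : IsFiniteMeasure (volume.restrict (Metric.closedBall (0 : R3) (2 ^ k))) :=
    ⟨by rw [Measure.restrict_apply_univ]; exact measure_closedBall_lt_top⟩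
  rw [← integrableOn_iff_integrable_of_support_subset hsupp]
  exact ((μ.memLp_localizedSpectrum k F).restrict _).integrable one_le_two

theorem DyadicCutoff.isFrequencyProfile_localizedSpectrum :
    IsFrequencyProfile (2 * Real.pi)⁻¹ (min (2 ^ (-k)) 1) (μ.localizedSpectrum k F) where
  integrable := μ.integrable_localizedSpectrum k F
  memLp_two := μ.memLp_localizedSpectrum k F
  norm_le ζ hζ := by
    have hle : (min ((2 : ℝ) ^ (-k)) 1) ≤ ((2 : ℝ) ^ k)⁻¹ := by
      rw [← zpow_neg]
      exact min_le_left _ _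
    exact (μ.norm_le_of_localizedSpectrum_ne_zero k F hζ).trans
      (le_inv_of_le_inv₀ (by positivity) hle)
  ne_zero ζ hζ hζ0 := by
    have hpos : (0 : ℝ) < 2 ^ k := by positivity
    have hlower := (μ.norm_mem_Icc_of_localizedSpectrum_ne_zero k F hζ).1
    rw [hζ0, norm_zero] at hlower
    linarith
  abs_inner_le ζ hζ u hu hR := by
    have hlower := (μ.norm_mem_Icc_of_localizedSpectrum_ne_zero k F hζ).1
    rcases min_choice ((2 : ℝ) ^ (-k)) 1 with hε | hε <;> rw [hε]
    · refine hR.trans ?_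
      rw [zpow_neg, inv_le_iff_one_le_mul₀' Real.two_pi_pos]
      have hpos : (0 : ℝ) < 2 ^ k := by positivity
      field_simp
      nlinarith
    · calc |inner ℝ ζ u| ≤ ‖ζ‖ * ‖u‖ := abs_real_inner_le_norm ζ u
        _ ≤ 3 * 1 * ‖ζ‖ := by nlinarith [norm_nonneg ζ]

theorem freqLocalize_ae_eq : freqLocalize μ k F =ᵐ[volume] 𝓕⁻ (μ.localizedSpectrum k F) :=
  fourierInv_toLp_ae_eq (μ.integrable_localizedSpectrum k F) (μ.memLp_localizedSpectrum k F)

theorem eLpNorm_freqLocalize_sq :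
    eLpNorm (freqLocalize μ k F) 2 volume ^ 2 = ∫⁻ ζ, ‖μ.localizedSpectrum k F ζ‖ₑ ^ 2 := by
  rw [← eLpNorm_two_sq]
  exact congrArg (· ^ 2) (eLpNorm_fourierInv_toLp (μ.memLp_localizedSpectrum k F))

end LocalizedSpectrum

section FrequencyLocalized

variable (μ : DyadicCutoff) (k : ℤ) (F : Lp ℂ 2 (volume : Measure R3))

theorem ae_integrable_freqLocalize_line_mul {f : ℝ → ℂ} (hf : Integrable f) (v : R3) :
    ∀ᵐ x : R3, Integrable fun t : ℝ => freqLocalize μ k F (x + t • v) * f t := by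
  filter_upwards [ae_ae_line (freqLocalize_ae_eq μ k F) v] with x hx
  refine (integrable_fourierInv_line_mul hf (μ.integrable_localizedSpectrum k F) v x).congr ?_
  filter_upwards [hx] with t ht
  rw [ht]

theorem aestronglyMeasurable_directionalMax_freqLocalize (ψ : SchwartzMap ℝ ℝ) (S : Finset R3) :
    AEStronglyMeasurable (directionalMax ψ S (freqLocalize μ k F)) :=
  (continuous_directionalMax_fourierInv ψ S
    (μ.integrable_localizedSpectrum k F)).aestronglyMeasurable.congr
      (directionalMax_congr_ae ψ S (freqLocalize_ae_eq μ k F)).symm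

theorem eLpNorm_directionalMax_freqLocalize_sq (ψ : SchwartzMap ℝ ℝ) (S : Finset R3) :
    eLpNorm (directionalMax ψ S (freqLocalize μ k F)) 2 volume ^ 2 =
      ∫⁻ x, ⨆ v ∈ S, ‖𝓕⁻ (ridgeSymbol (μ.localizedSpectrum k F) (averageSymbol ψ) v) x‖ₑ ^ 2 := by
  simp_rw [eLpNorm_congr_ae (directionalMax_congr_ae ψ S (freqLocalize_ae_eq μ k F)),
    eLpNorm_two_sq, enorm_sq_directionalMax,
    directionalAverage_fourierInv ψ (μ.integrable_localizedSpectrum k F)]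

end FrequencyLocalized

theorem exists_eLpNorm_directionalMax_freqLocalize_sq_le (ψ : SchwartzMap ℝ ℝ)
    (hψ : Function.support (angularFourier ψ) ⊆ Set.Icc (-1 : ℝ) 1) {c : ℝ} (hc : 0 < c) :
    ∃ K > 0, ∀ (μ : DyadicCutoff) (S : Finset R3) (ρ : ℝ), 0 < ρ → ρ ≤ 1 → (∀ v ∈ S, ‖v‖ = 1) →
      (∀ v ∈ S, ∀ w ∈ S, v ≠ w → c * ρ ≤ ‖v - w‖) →
      ∀ (k : ℤ) (F : Lp ℂ 2 (volume : Measure R3)),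
        eLpNorm (directionalMax ψ S (freqLocalize μ k F)) 2 volume ^ 2 ≤
          ENNReal.ofReal (K / ρ) * eLpNorm (freqLocalize μ k F) 2 volume ^ 2 := by
  obtain ⟨b, hb0, hb⟩ := exists_norm_iteratedDeriv_le (averageSymbol ψ) 3
  refine ⟨b ^ 2 * (6144 * Real.pi + 12 * (3 + c / 2) * (2 + c / 2) / c ^ 2), by positivity,
    fun μ S ρ hρ hρ1 hS hsep k F => ?_⟩
  rw [eLpNorm_directionalMax_freqLocalize_sq, eLpNorm_freqLocalize_sq]
  exact lintegral_iSup_separated_le (by positivity) (min_le_right _ _) hρ hρ1 hc hS hsep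
    (μ.isFrequencyProfile_localizedSpectrum k F) ((averageSymbol ψ).smooth 3) hb
    fun s => abs_le_of_averageSymbol_ne_zero hψ

theorem proposition3p1_general (ψ : SchwartzMap ℝ ℝ)
    (hψ_supp : Function.support (angularFourier ψ) ⊆ Set.Icc (-1 : ℝ) 1)
    (c : ℝ) (hc : 0 < c) :
    ∃ C : ℝ, 0 < C ∧
      ∀ (μ : DyadicCutoff) (N : ℕ) (S : Finset R3), S.card = N →
        (∀ v ∈ S, ‖v‖ = 1) →
        (∀ v ∈ S, ∀ w ∈ S, v ≠ w → c * (N : ℝ) ^ (-(1 / 2) : ℝ) ≤ ‖v - w‖) →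
        ∀ (k : ℤ) (F : Lp ℂ 2 (volume : Measure R3)),
          (∀ v ∈ S, ∀ᵐ x : R3,
            Integrable (fun t : ℝ => freqLocalize μ k F (x + t • v) * (ψ t : ℂ))) ∧
          MemLp (directionalMax ψ S (freqLocalize μ k F)) 2 volume ∧
          eLpNorm (directionalMax ψ S (freqLocalize μ k F)) 2 volume ≤
            ENNReal.ofReal (C * (N : ℝ) ^ (1 / 4 : ℝ)) *
              eLpNorm (freqLocalize μ k F) 2 volume := by
  obtain ⟨K, hK, hmax⟩ := exists_eLpNorm_directionalMax_freqLocalize_sq_le ψ hψ_supp hc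
  refine ⟨√K, Real.sqrt_pos.2 hK, fun μ N S hN hS hsep k F => ?_⟩
  have hle : eLpNorm (directionalMax ψ S (freqLocalize μ k F)) 2 volume ≤
      ENNReal.ofReal (√K * (N : ℝ) ^ (1 / 4 : ℝ)) * eLpNorm (freqLocalize μ k F) 2 volume := by
    rcases S.eq_empty_or_nonempty with rfl | hne
    · simp [funext fun x => show directionalMax ψ ∅ (freqLocalize μ k F) x = 0 from rfl]
    have hN1 : (1 : ℝ) ≤ N := by exact_mod_cast hN ▸ hne.card_pos
    have hsq : K / (N : ℝ) ^ (-(1 / 2) : ℝ) = (√K * (N : ℝ) ^ (1 / 4 : ℝ)) ^ 2 := by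
      rw [mul_pow, Real.sq_sqrt hK.le, ← Real.rpow_mul_natCast (by positivity),
        Real.rpow_neg (by positivity), div_inv_eq_mul]
      norm_num
    refine (ENNReal.pow_le_pow_left_iff two_ne_zero).1 ?_
    rw [mul_pow, ← ENNReal.ofReal_pow (by positivity), ← hsq]
    exact hmax μ S _ (by positivity)
      (Real.rpow_le_one_of_one_le_of_nonpos hN1 (by norm_num)) hS hsep k F
  exact ⟨fun v _ => ae_integrable_freqLocalize_line_mul μ k F ψ.integrable.ofReal v,
    ⟨aestronglyMeasurable_directionalMax_freqLocalize μ k F ψ S,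
      hle.trans_lt (ENNReal.mul_lt_top ENNReal.ofReal_lt_top (Lp.eLpNorm_lt_top _))⟩, hle⟩

theorem proposition3p1
    (ψ : SchwartzMap ℝ ℝ) (hψ_nonneg : ∀ t : ℝ, 0 ≤ ψ t)
    (hψ_supp : Function.support (angularFourier ψ) ⊆ Set.Icc (-1 : ℝ) 1)
    (c : ℝ) (hc : 0 < c) :
    ∃ C : ℝ, 0 < C ∧
      ∀ (μ : DyadicCutoff) (N : ℕ) (S : Finset R3), S.card = N →
        (∀ v ∈ S, ‖v‖ = 1) →
        (∀ v ∈ S, ∀ w ∈ S, v ≠ w → c * (N : ℝ) ^ (-(1 / 2) : ℝ) ≤ ‖v - w‖) →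
        ∀ (k : ℤ), 0 ≤ k → ∀ F : Lp ℂ 2 (volume : Measure R3),
          -- the integrals defining the averages converge almost everywhere
          (∀ v ∈ S, ∀ᵐ x : R3,
            Integrable (fun t : ℝ => freqLocalize μ k F (x + t • v) * (ψ t : ℂ))) ∧
          MemLp (directionalMax ψ S (freqLocalize μ k F)) 2 volume ∧
          eLpNorm (directionalMax ψ S (freqLocalize μ k F)) 2 volume ≤
            ENNReal.ofReal (C * (N : ℝ) ^ (1 / 4 : ℝ)) *
              eLpNorm (freqLocalize μ k F) 2 volume := by
  obtain ⟨C, hC, h⟩ := proposition3p1_general ψ hψ_supp c hc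
  exact ⟨C, hC, fun μ N S hN hS hsep k _ F => h μ N S hN hS hsep k F⟩
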